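/- Consider three qubits $A$, $B$, $C$ and the real vector space of self-adjoint matrices in $M_2\otimes M_2\otimes M_2$, viewed as $8\times 8$ matrices in the lexicographic order of indices. Let $\alpha$ be the convex cone of $A$-$BC$ separable un-normalized states, that is, of all finite sums $\sum_k |\psi_k\rangle\langle\psi_k|$ in which each $\psi_k\in\mathbb C^2\otimes\mathbb C^2\otimes\mathbb C^2$ is a product vector for the bipartition $A$-$BC$. Let $\beta$ and $\gamma$ be the analogous cones for the bipartitions $B$-$CA$ and $C$-$AB$. For convex cones write $\sigma\wedge\tau=\sigma\cap\tau$ and let $\sigma\vee\tau$ be the convex hull of $\sigma\cup\tau$ (equivalently $\sigma+\tau$). Let $X$ be the real vector space of self-adjoint $8\times 8$ matrices all of whose entries off the diagonal and the anti-diagonal are zero, and put $\sigma_X=\sigma\cap X$. Set $$Q=[\alpha\wedge(\beta\vee\gamma)]\vee[\beta\wedge(\gamma\vee\alpha)]\vee[\gamma\wedge(\alpha\vee\beta)].$$ Then $$(\alpha_X\vee\beta_X)\wedge(\alpha_X\vee\gamma_X)=\alpha_X\vee Q_X,$$ $$(\beta_X\vee\gamma_X)\wedge(\beta_X\vee\alpha_X)=\beta_X\vee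 Q_X,$$ $$(\gamma_X\vee\alpha_X)\wedge(\gamma_X\vee\beta_X)=\gamma_X\vee Q_X.$$ -/

import Mathlib

noncomputable section

namespace ThreeQubit

/-- Index set of the computational basis of `ℂ² ⊗ ℂ² ⊗ ℂ²`; the three components belong to the
subsystems `A`, `B`, `C`. In lexicographic order `(i, j, k)` is the row `4 i + 2 j + k` of an
`8 × 8` matrix. -/
abbrev Idx : Type := Fin 2 × Fin 2 × Fin 2

/-- Three qubit matrices, i.e. elements of `M₂ ⊗ M₂ ⊗ M₂`. -/
abbrev Mat : Type := Matrix Idx Idx ℂ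

/-- The rank one matrix `|ψ⟩⟨ψ|`, the un-normalized pure state given by the vector `ψ`. -/
def rankOne (ψ : Idx → ℂ) : Mat := Matrix.vecMulVec ψ (star ψ)

/-- The product vector `x ⊗ y` with `x` in system `A` and `y` in system `BC`. -/
def prodA (x : Fin 2 → ℂ) (y : Fin 2 × Fin 2 → ℂ) : Idx → ℂ :=
  fun i => x i.1 * y (i.2.1, i.2.2)

/-- The product vector `x ⊗ y` with `x` in system `B` and `y` in system `CA`. -/
def prodB (x : Fin 2 → ℂ) (y : Fin 2 × Fin 2 → ℂ) : Idx → ℂ :=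
  fun i => x i.2.1 * y (i.2.2, i.1)

/-- The product vector `x ⊗ y` with `x` in system `C` and `y` in system `AB`. -/
def prodC (x : Fin 2 → ℂ) (y : Fin 2 × Fin 2 → ℂ) : Idx → ℂ :=
  fun i => x i.2.2 * y (i.1, i.2.1)

/-- The convex cone of `A`-`BC` separable un-normalized states: finite nonnegative combinations
of pure product states for the bipartition `A`-`BC`. -/
def sepA : PointedCone ℝ Mat :=
  PointedCone.hull ℝ {ρ | ∃ x y, ρ = rankOne (prodA x y)}

/-- The convex cone of `B`-`CA` separable un-normalized states. -/
def sepB : PointedCone ℝ Mat :=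
  PointedCone.hull ℝ {ρ | ∃ x y, ρ = rankOne (prodB x y)}

/-- The convex cone of `C`-`AB` separable un-normalized states. -/
def sepC : PointedCone ℝ Mat :=
  PointedCone.hull ℝ {ρ | ∃ x y, ρ = rankOne (prodC x y)}

/-- Flip all three bits. In lexicographic order this sends row `r` to row `7 - r`, so that the
entries at `(i, bitFlip i)` are the anti-diagonal ones. -/
def bitFlip (i : Idx) : Idx := (i.1.rev, i.2.1.rev, i.2.2.rev)

/-- The real vector space of all three qubit X-shaped self-adjoint matrices: all the entries off
the diagonal and the anti-diagonal are zero. -/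
def XSpace : Submodule ℝ Mat where
  carrier := {M | M.IsHermitian ∧ ∀ i j, j ≠ i → j ≠ bitFlip i → M i j = 0}
  add_mem' := by
    rintro M N ⟨hM, hM'⟩ ⟨hN, hN'⟩
    exact ⟨hM.add hN, fun i j h h' => by simp [hM' i j h h', hN' i j h h']⟩
  zero_mem' := ⟨Matrix.isHermitian_zero, fun _ _ _ _ => rfl⟩
  smul_mem' := by
    rintro c M ⟨hM, hM'⟩
    refine ⟨?_, fun i j h h' => by simp [hM' i j h h']⟩
    show (c • M).conjTranspose = c • M
    rw [Matrix.conjTranspose_smul, hM.eq, star_trivial]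

/-- `σ_X = σ ∩ X`. In the lattice of pointed convex cones of three qubit matrices, the meet `⊓` is
the intersection and the join `⊔` is the convex hull of the union, see `coe_sup_eq_convexHull`. -/
def xPart (σ : PointedCone ℝ Mat) : PointedCone ℝ Mat :=
  σ ⊓ PointedCone.ofSubmodule XSpace

/-- The join of two pointed convex cones is the convex hull of their union. -/
theorem coe_sup_eq_convexHull (σ τ : PointedCone ℝ Mat) :
    ((σ ⊔ τ : PointedCone ℝ Mat) : Set Mat) = convexHull ℝ ((σ : Set Mat) ∪ (τ : Set Mat)) := by
  apply Set.Subset.antisymm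
  · intro x hx
    obtain ⟨c, hc, d, hd, rfl⟩ := Submodule.mem_sup.1 hx
    have h2 : ∀ υ : PointedCone ℝ Mat, ∀ v ∈ υ, (2 : ℝ) • v ∈ υ := fun υ v hv =>
      υ.smul_mem (by norm_num : (0 : ℝ) ≤ 2) hv
    have key := (convex_convexHull ℝ ((σ : Set Mat) ∪ (τ : Set Mat)))
      (subset_convexHull ℝ _ (Or.inl (h2 σ c hc))) (subset_convexHull ℝ _ (Or.inr (h2 τ d hd)))
      (by norm_num : (0 : ℝ) ≤ 1 / 2) (by norm_num : (0 : ℝ) ≤ 1 / 2) (by norm_num)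
    rw [smul_smul, smul_smul] at key
    norm_num at key
    exact key
  · refine convexHull_min ?_ (PointedCone.toConvexCone (σ ⊔ τ)).convex
    rintro x (hx | hx)
    · exact Submodule.mem_sup_left hx
    · exact Submodule.mem_sup_right hx

/-- `Q = [α ∧ (β ∨ γ)] ∨ [β ∧ (γ ∨ α)] ∨ [γ ∧ (α ∨ β)]`. -/
def Q : PointedCone ℝ Mat :=
  (sepA ⊓ (sepB ⊔ sepC)) ⊔ (sepB ⊓ (sepC ⊔ sepA)) ⊔ (sepC ⊓ (sepA ⊔ sepB))

end ThreeQubit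

end

noncomputable section

namespace ThreeQubit

/-! For an X-shaped matrix everything is decided by two functions on the four pairs of opposite
indices: `r` (`diagMean`) and `w` (`antiAbs`). Flipping one qubit translates the pairs by some `t`:
(1,1) for A, (1,0) for B, (0,1) for C, and any two of these sum to the third. An X-shaped matrix
with nonnegative diagonal is separable for that bipartition exactly when `w v` is at most `r v` and
`r (v + t)` (`IsSepCone`).

A sum of two separable matrices then satisfies `JointlyDominates`. The core is
`dominates_or_splits`, pure linear arithmetic: joint domination for `a, b` and for `a, c` gives
either domination for `a`, or a splitting into a part dominated for `a` and a part that is dominated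
for one of `b`, `c` and is a sum of parts dominated for the other two shifts. `exists_splitting`
lifts this to matrices, where the second part lies in `Q`.

For the reverse inclusion, `Q` lies below every join of two of the cones, and the projection `toX`
preserves each cone, so the X-part of a join is the join of the X-parts. -/

/-! ### Linear inequalities on four pairs. -/

/-- Index set of the four pairs `{i, bitFlip i}`. -/
abbrev Pair : Type := Fin 2 × Fin 2

/-- The real inequalities describing X-shaped separable states, in terms of the geometric means
`r` of the diagonal entries and the moduli `w` of the anti-diagonal entries. -/
def Dominates (t : Pair) (r w : Pair → ℝ) : Prop :=
  ∀ v, w v ≤ r v ∧ w v ≤ r (v + t)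

theorem Dominates.add {t : Pair} {r w r' w' : Pair → ℝ} (h : Dominates t r w)
    (h' : Dominates t r' w') : Dominates t (r + r') (w + w') := fun v =>
  ⟨add_le_add (h v).1 (h' v).1, add_le_add (h v).2 (h' v).2⟩

theorem Dominates.mono {t : Pair} {r w r' w' : Pair → ℝ} (h : Dominates t r w)
    (hr : r ≤ r') (hw : w' ≤ w) : Dominates t r' w' := fun v =>
  ⟨(hw v).trans ((h v).1.trans (hr v)), (hw v).trans ((h v).2.trans (hr _))⟩

/-- The inequalities describing sums of two families of dominated vectors. -/
def JointlyDominates (s t : Pair) (r w : Pair → ℝ) : Prop :=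
  ∀ v, w v ≤ r v ∧ w v + w (v + s + t) ≤ r (v + s) + r (v + t)

theorem pair_add_self (v s : Pair) : v + s + s = v := by
  revert v s; decide

/-- Translation by `s` sends `v` to `v + s` and `v + s + t` to `v + t`; translation by `t` does the
same crosswise. Either way the two values of `w` are bounded by the same two values of `r`. -/
theorem Dominates.joint {s t : Pair} {r w r' w' : Pair → ℝ} (h : Dominates s r w)
    (h' : Dominates t r' w') : JointlyDominates s t (r + r') (w + w') := by
  intro v
  have h1 := h v
  have h2 := h' v
  have h3 := h (v + s + t)
  have h4 := h' (v + s + t)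
  rw [add_right_comm v s t, pair_add_self, add_right_comm v t s] at h3
  rw [pair_add_self] at h4
  have h5 : w (v + s + t) ≤ r (v + t) := h3.2
  simp only [Pi.add_apply]
  constructor <;> linarith [h1.1, h1.2, h2.1, h2.2, h4.1, h4.2]

theorem JointlyDominates.mono {s t : Pair} {r w r' w' : Pair → ℝ} (h : JointlyDominates s t r w)
    (hr : r ≤ r') (hw : w' ≤ w) : JointlyDominates s t r' w' := fun v =>
  ⟨(hw v).trans ((h v).1.trans (hr v)),
    (add_le_add (hw _) (hw _)).trans ((h v).2.trans (add_le_add (hr _) (hr _)))⟩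

/-- A splitting of `(r, w)` into a part dominated for `a` and the sum of a part dominated for `a`
and a part dominated for `b`, this sum being dominated for `c`. -/
def Splits (a b c : Pair) (r w : Pair → ℝ) : Prop :=
  ∃ r₁ w₁ r₂ w₂ r₃ w₃ : Pair → ℝ,
    (0 ≤ r₁ ∧ 0 ≤ w₁ ∧ 0 ≤ r₂ ∧ 0 ≤ w₂ ∧ 0 ≤ r₃ ∧ 0 ≤ w₃) ∧
    r = r₁ + (r₂ + r₃) ∧ w = w₁ + (w₂ + w₃) ∧
    Dominates a r₁ w₁ ∧ Dominates a r₂ w₂ ∧ Dominates b r₃ w₃ ∧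
    Dominates c (r₂ + r₃) (w₂ + w₃)

theorem pair_cases {a b c : Pair} (ha : a ≠ 0) (hb : b ≠ 0) (hab : a ≠ b) (hc : c = a + b)
    (i v : Pair) : v = i ∨ v = i + a ∨ v = i + b ∨ v = i + c := by
  subst hc; revert a b i v; decide

/-- The violation of domination at `i` is moved into a piece, supported on `i`, `i + b`, `i + c`,
that is dominated for `c`; what remains is dominated for `a`. -/
theorem splits_of_defect {a b c : Pair} (ha : a ≠ 0) (hb : b ≠ 0) (hab : a ≠ b) (hc : c = a + b)
    {r w : Pair → ℝ} (hw : 0 ≤ w) (hJb : JointlyDominates a b r w)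
    (hJc : JointlyDominates a c r w) (i : Pair) (hi : r (i + a) < w i)
    (hib : w i - r (i + a) + w (i + b) ≤ r (i + b)) : Splits a b c r w := by
  have cases_v := pair_cases ha hb hab hc i
  have hc0 : c ≠ 0 := by subst hc; clear * - hab; revert a b; decide
  have hac : a ≠ c := by subst hc; clear * - hb; revert a b; decide
  have hbc : b ≠ c := by subst hc; clear * - ha; revert a b; decide
  have e1 : i + a + b = i + c := by rw [hc, add_assoc]
  have e2 : i + a + c = i + b := by subst hc; rw [← add_assoc, pair_add_self]
  have e3 : i + b + a = i + c := by rw [add_right_comm, e1]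
  have e4 : i + c + a = i + b := by rw [add_right_comm, e2]
  have e5 : i + b + c = i + a := by rw [← e2, pair_add_self]
  have e6 : i + c + b = i + a := by rw [← e1, pair_add_self]
  have e7 := pair_add_self i a
  have e8 := pair_add_self i b
  have e9 := pair_add_self i c
  have w0 := hw i
  have wa := hw (i + a)
  have wb := hw (i + b)
  have wc := hw (i + c)
  simp only [Pi.zero_apply] at w0 wa wb wc
  have r0 := (hJb i).1
  have ra := (hJb (i + a)).1
  have rb := (hJb (i + b)).1
  have rc := (hJb (i + c)).1
  have j1 := (hJb i).2
  have j2 := (hJc i).2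
  have j3 := (hJb (i + a)).2
  have j4 := (hJc (i + a)).2
  rw [e1] at j1
  rw [e2] at j2
  rw [e7, e1] at j3
  rw [e7, e2] at j4
  obtain ⟨δ, hδ⟩ : ∃ δ, δ = w i - r (i + a) := ⟨_, rfl⟩
  -- The remainder loses `δ` from `r (i + c)`, so `w (i + c)` must lose at least `ε`, the least
  -- amount restoring `w ≤ r` there. The bound with `δ + ε` is `hib` when `ε = 0`, and otherwise the
  -- sum of `j1` and `j2`.
  obtain ⟨ε, hε0, hε1, hε2, hε3, hε4⟩ : ∃ ε : ℝ, 0 ≤ ε ∧ δ + w (i + c) - r (i + c) ≤ ε ∧ ε ≤ δ ∧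
      ε ≤ w (i + c) ∧ δ + ε + w (i + b) ≤ r (i + b) ∧ δ + w (i + c) ≤ r (i + b) := by
    refine ⟨max 0 (δ + w (i + c) - r (i + c)), le_max_left _ _, le_max_right _ _,
      max_le ?_ ?_, max_le ?_ ?_, ?_, ?_⟩
    · linarith
    · linarith
    · linarith
    · linarith
    · rcases max_cases 0 (δ + w (i + c) - r (i + c)) with h | h <;> linarith
    · linarith
  obtain ⟨F, hF⟩ : ∃ F : ℝ → ℝ → ℝ → ℝ → Pair → ℝ, ∀ x y z u,
      F x y z u i = x ∧ F x y z u (i + a) = y ∧ F x y z u (i + b) = z ∧ F x y z u (i + c) = u := by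
    refine ⟨fun x y z u v => if v = i then x else if v = i + a then y else if v = i + b then z
      else u, fun x y z u => ?_⟩
    simp [ha, hb, hc0, hab.symm, hac.symm, hbc.symm]
  have F0 := fun x y z u => (hF x y z u).1
  have Fa := fun x y z u => (hF x y z u).2.1
  have Fb := fun x y z u => (hF x y z u).2.2.1
  have Fc := fun x y z u => (hF x y z u).2.2.2
  have all : ∀ P : Pair → Prop, P i → P (i + a) → P (i + b) → P (i + c) → ∀ v, P v := by
    intro P h1 h2 h3 h4 v
    rcases cases_v v with rfl | rfl | rfl | rfl <;> assumption
  -- The arguments of `F` are the values at `i`, `i + a`, `i + b`, `i + c`. The last two pieces add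
  -- up to `r = (δ, 0, δ + ε, δ)` and `w = (δ, 0, 0, ε)`, dominated for `c` because `ε ≤ δ`.
  refine ⟨F (r i - δ) (r (i + a)) (r (i + b) - δ - ε) (r (i + c) - δ),
    F (w i - δ) (w (i + a)) (w (i + b)) (w (i + c) - ε),
    F 0 0 ε δ, F 0 0 0 ε, F δ 0 δ 0, F δ 0 0 0, ⟨all _ ?_ ?_ ?_ ?_, all _ ?_ ?_ ?_ ?_,
      all _ ?_ ?_ ?_ ?_, all _ ?_ ?_ ?_ ?_, all _ ?_ ?_ ?_ ?_, all _ ?_ ?_ ?_ ?_⟩,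
    funext (all _ ?_ ?_ ?_ ?_), funext (all _ ?_ ?_ ?_ ?_), all _ ?_ ?_ ?_ ?_, all _ ?_ ?_ ?_ ?_,
    all _ ?_ ?_ ?_ ?_, all _ ?_ ?_ ?_ ?_⟩ <;>
  simp only [Pi.zero_apply, Pi.add_apply, e1, e2, e3, e4, e5, e6, e7, e8, e9, F0, Fa, Fb, Fc] <;>
  first
  | linarith
  | constructor <;> linarith

/-- A jointly dominated vector that is not dominated splits. -/
theorem dominates_or_splits {a b c : Pair} (ha : a ≠ 0) (hb : b ≠ 0) (hab : a ≠ b)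
    (hc : c = a + b) {r w : Pair → ℝ} (hw : 0 ≤ w) (hJb : JointlyDominates a b r w)
    (hJc : JointlyDominates a c r w) :
    Dominates a r w ∨ Splits a b c r w ∨ Splits a c b r w := by
  by_cases h : Dominates a r w
  · exact Or.inl h
  right
  obtain ⟨i, hi⟩ : ∃ i, r (i + a) < w i := by
    by_contra! h'
    exact h fun v => ⟨(hJb v).1, h' v⟩
  by_cases hib : w i - r (i + a) + w (i + b) ≤ r (i + b)
  · exact Or.inl (splits_of_defect ha hb hab hc hw hJb hJc i hi hib)
  right
  have hc0 : c ≠ 0 := by subst hc; clear * - hab; revert a b; decide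
  have hac : a ≠ c := by subst hc; clear * - hb; revert a b; decide
  have hb' : b = a + c := by subst hc; clear * -; revert a b; decide
  -- If `hib` fails, then `r (i + b) < δ + w (i + b) ≤ r (i + c)` with `δ = w i - r (i + a)`, so `δ
  -- + w (i + c) ≤ r (i + b)` gives the same condition with `b` and `c` exchanged.
  refine splits_of_defect ha hc0 hac hb' hw hJc hJb i hi ?_
  have j1 := (hJb i).2
  have j2 := (hJc i).2
  rw [add_assoc, ← hc] at j1
  rw [add_assoc, ← hb'] at j2
  linarith

/-! ### Invariants of a matrix and necessary conditions for separability. -/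

/-- The class of an index modulo `bitFlip`. -/
def pairOf (i : Idx) : Pair := (i.1 + i.2.1, i.1 + i.2.2)

/-- A representative of a class modulo `bitFlip`. -/
def rep (v : Pair) : Idx := (0, v.1, v.2)

@[simp] theorem pairOf_rep (v : Pair) : pairOf (rep v) = v := by revert v; decide

@[simp] theorem pairOf_bitFlip (i : Idx) : pairOf (bitFlip i) = pairOf i := by revert i; decide

@[simp] theorem bitFlip_bitFlip (i : Idx) : bitFlip (bitFlip i) = i := by revert i; decide

@[simp] theorem bitFlip_ne (i : Idx) : bitFlip i ≠ i := by revert i; decide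

@[simp] theorem ne_bitFlip (i : Idx) : i ≠ bitFlip i := by revert i; decide

theorem eq_rep_pairOf (i : Idx) : i = rep (pairOf i) ∨ i = bitFlip (rep (pairOf i)) := by
  revert i; decide

/-- The geometric means of the diagonal entries. -/
def diagMean (M : Mat) (v : Pair) : ℝ :=
  √((M (rep v) (rep v)).re * (M (bitFlip (rep v)) (bitFlip (rep v))).re)

/-- The moduli of the anti-diagonal entries. -/
def antiAbs (M : Mat) (v : Pair) : ℝ := ‖M (rep v) (bitFlip (rep v))‖

theorem antiAbs_nonneg (M : Mat) : 0 ≤ antiAbs M := fun _ => norm_nonneg _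

/-- Nonnegativity of the diagonal. -/
def DiagNonneg (M : Mat) : Prop := ∀ i, 0 ≤ (M i i).re

/-- Cauchy–Schwarz for `(√a, √c)` and `(√b, √d)`; it makes `diagMean` superadditive. -/
theorem sqrt_mul_add_sqrt_mul_le {a b c d : ℝ} (ha : 0 ≤ a) (hb : 0 ≤ b) (hc : 0 ≤ c)
    (hd : 0 ≤ d) : √(a * b) + √(c * d) ≤ √((a + c) * (b + d)) := by
  apply Real.le_sqrt_of_sq_le
  rw [Real.sqrt_mul ha, Real.sqrt_mul hc]
  nlinarith [Real.sq_sqrt ha, Real.sq_sqrt hb, Real.sq_sqrt hc, Real.sq_sqrt hd,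
    sq_nonneg (√a * √d - √c * √b), mul_nonneg ha hb]

theorem diagMean_add_le {M N : Mat} (hM : DiagNonneg M) (hN : DiagNonneg N) :
    diagMean M + diagMean N ≤ diagMean (M + N) := fun _ => by
  simpa [diagMean] using sqrt_mul_add_sqrt_mul_le (hM _) (hM _) (hN _) (hN _)

theorem antiAbs_add_le (M N : Mat) : antiAbs (M + N) ≤ antiAbs M + antiAbs N := fun _ =>
  norm_add_le _ _

/-- The necessary conditions for separability. -/
def Admissible (t : Pair) (M : Mat) : Prop :=
  M.IsHermitian ∧ DiagNonneg M ∧ Dominates t (diagMean M) (antiAbs M)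

theorem Admissible.add {t : Pair} {M N : Mat} (hM : Admissible t M) (hN : Admissible t N) :
    Admissible t (M + N) :=
  ⟨hM.1.add hN.1, fun i => add_nonneg (hM.2.1 i) (hN.2.1 i),
    (hM.2.2.add hN.2.2).mono (diagMean_add_le hM.2.1 hN.2.1) (antiAbs_add_le M N)⟩

theorem admissible_zero (t : Pair) : Admissible t 0 :=
  ⟨Matrix.isHermitian_zero, fun _ => le_rfl, fun _ => by simp [diagMean, antiAbs]⟩

theorem Admissible.smul {t : Pair} {M : Mat} (hM : Admissible t M) {c : ℝ} (hc : 0 ≤ c) :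
    Admissible t (c • M) := by
  have h1 : diagMean (c • M) = c • diagMean M := by
    funext v
    have : ∀ x y : ℝ, c * x * (c * y) = c ^ 2 * (x * y) := fun x y => by ring
    simp [diagMean, this, Real.sqrt_mul, sq_nonneg, Real.sqrt_sq hc]
  have h2 : antiAbs (c • M) = c • antiAbs M := by
    funext v
    simp [antiAbs, abs_of_nonneg hc]
  refine ⟨?_, fun i => by simpa using mul_nonneg hc (hM.2.1 i), fun v => ?_⟩
  · show (c • M).conjTranspose = c • M
    rw [Matrix.conjTranspose_smul, hM.1.eq, star_trivial]
  · rw [h1, h2]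
    exact ⟨mul_le_mul_of_nonneg_left (hM.2.2 v).1 hc, mul_le_mul_of_nonneg_left (hM.2.2 v).2 hc⟩

theorem admissible_of_mem_hull {t : Pair} {S : Set Mat} (hS : ∀ M ∈ S, Admissible t M) {M : Mat}
    (hM : M ∈ PointedCone.hull ℝ S) : Admissible t M := by
  induction hM using Submodule.span_induction with
  | mem x hx => exact hS x hx
  | zero => exact admissible_zero t
  | add x y _ _ hx hy => exact hx.add hy
  | smul c x _ hx => exact hx.smul c.2

theorem rankOne_apply (ψ : Idx → ℂ) (i j : Idx) :
    rankOne ψ i j = ψ i * (starRingEnd ℂ) (ψ j) := rfl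

/-- Rank one matrices of vectors with equal products along two pairs are admissible. -/
theorem admissible_rankOne {t : Pair} {ψ : Idx → ℂ}
    (h : ∀ v, ‖ψ (rep v)‖ * ‖ψ (bitFlip (rep v))‖ =
      ‖ψ (rep (v + t))‖ * ‖ψ (bitFlip (rep (v + t)))‖) :
    Admissible t (rankOne ψ) := by
  have h1 : ∀ i, (rankOne ψ i i).re = ‖ψ i‖ ^ 2 := fun i => by
    rw [rankOne_apply, Complex.mul_conj']; norm_cast
  have h2 : ∀ v, antiAbs (rankOne ψ) v = ‖ψ (rep v)‖ * ‖ψ (bitFlip (rep v))‖ := fun v => by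
    simp [antiAbs, rankOne_apply]
  have h3 : ∀ v, diagMean (rankOne ψ) v = ‖ψ (rep v)‖ * ‖ψ (bitFlip (rep v))‖ := fun v => by
    rw [diagMean, h1, h1, ← mul_pow, Real.sqrt_sq (by positivity)]
  refine ⟨?_, fun i => by rw [h1]; positivity, fun v => ?_⟩
  · ext i j
    simp [rankOne_apply, mul_comm]
  · rw [h2, h3, h3, ← h]
    exact ⟨le_rfl, le_rfl⟩

theorem admissible_of_mem_sepA {M : Mat} (hM : M ∈ sepA) : Admissible (1, 1) M := by
  refine admissible_of_mem_hull ?_ hM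
  rintro _ ⟨x, y, rfl⟩
  refine admissible_rankOne fun v => ?_
  obtain ⟨j, k⟩ := v
  fin_cases j <;> fin_cases k <;> simp [prodA, rep, bitFlip] <;> ring

theorem admissible_of_mem_sepB {M : Mat} (hM : M ∈ sepB) : Admissible (1, 0) M := by
  refine admissible_of_mem_hull ?_ hM
  rintro _ ⟨x, y, rfl⟩
  refine admissible_rankOne fun v => ?_
  obtain ⟨j, k⟩ := v
  fin_cases j <;> fin_cases k <;> simp [prodB, rep, bitFlip] <;> ring

theorem admissible_of_mem_sepC {M : Mat} (hM : M ∈ sepC) : Admissible (0, 1) M := by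
  refine admissible_of_mem_hull ?_ hM
  rintro _ ⟨x, y, rfl⟩
  refine admissible_rankOne fun v => ?_
  obtain ⟨j, k⟩ := v
  fin_cases j <;> fin_cases k <;> simp [prodC, rep, bitFlip] <;> ring

/-! ### Projection onto X-shaped matrices by averaging over local signs. -/

/-- The X-shaped matrix with given diagonal and anti-diagonal entries. -/
def xMat (d o : Idx → ℂ) : Mat := fun i j => if j = i then d i else if j = bitFlip i then o i else 0

/-- The X-shaped part of a matrix. -/
def toX (M : Mat) : Mat := xMat (fun i => M i i) (fun i => M i (bitFlip i))

theorem toX_add (M N : Mat) : toX (M + N) = toX M + toX N := by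
  ext i j
  simp only [toX, xMat, Matrix.add_apply]
  split_ifs <;> simp

theorem toX_smul (c : ℝ) (M : Mat) : toX (c • M) = c • toX M := by
  ext i j
  simp only [toX, xMat, Matrix.smul_apply]
  split_ifs <;> simp

theorem toX_zero : toX 0 = 0 := by
  ext i j
  simp [toX, xMat]

theorem toX_of_mem {M : Mat} (hM : M ∈ XSpace) : toX M = M := by
  ext i j
  simp only [toX, xMat]
  split_ifs with h1 h2
  · rw [h1]
  · rw [h2]
  · exact (hM.2 i j h1 h2).symm

theorem toX_mem {M : Mat} (hM : M.IsHermitian) : toX M ∈ XSpace := by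
  refine ⟨?_, fun i j h h' => by simp [toX, xMat, h, h']⟩
  ext i j
  have h := congrFun₂ hM
  simp only [Matrix.conjTranspose_apply] at h ⊢
  by_cases h1 : i = j
  · subst h1; simp [toX, xMat, h]
  by_cases h2 : i = bitFlip j
  · subst h2; simp [toX, xMat, h]
  have h3 : j ≠ bitFlip i := fun h' => h2 (by rw [h', bitFlip_bitFlip])
  simp [toX, xMat, h1, Ne.symm h1, h2, h3]

/-- The diagonal sign matrices over which the projection averages. -/
def sgn (s t : Fin 2) (i : Idx) : ℂ :=
  (-1) ^ ((s : ℕ) * i.1 + (t : ℕ) * i.2.1 + (s + t : ℕ) * i.2.2)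

theorem sum_sign_mul_sign (i j : Idx) :
    (∑ s : Fin 2, ∑ t : Fin 2,
      ((-1) ^ ((s : ℕ) * i.1 + (t : ℕ) * i.2.1 + (s + t : ℕ) * i.2.2) *
        (-1) ^ ((s : ℕ) * j.1 + (t : ℕ) * j.2.1 + (s + t : ℕ) * j.2.2) : ℤ)) =
      if j = i ∨ j = bitFlip i then 4 else 0 := by
  revert i j; decide

/-- The exponents of `sgn` sum to an even number over the three qubits, so opposite indices get
equal signs and the anti-diagonal survives, while all other off-diagonal entries average out. Each
sign is a product of one-qubit signs, hence the average keeps product vectors product. -/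
theorem toX_rankOne (ψ : Idx → ℂ) :
    toX (rankOne ψ) =
      ∑ s : Fin 2, ∑ t : Fin 2, (1 / 4 : ℝ) • rankOne (fun i => sgn s t i * ψ i) := by
  ext i j
  have h1 : (∑ s : Fin 2, ∑ t : Fin 2, sgn s t i * sgn s t j) =
      if j = i ∨ j = bitFlip i then 4 else 0 := by
    have := congrArg (Int.cast : ℤ → ℂ) (sum_sign_mul_sign i j)
    push_cast at this
    exact this
  have h2 : (∑ s : Fin 2, ∑ t : Fin 2, (1 / 4 : ℝ) • rankOne (fun i => sgn s t i * ψ i)) i j =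
      (∑ s : Fin 2, ∑ t : Fin 2, sgn s t i * sgn s t j) * (1 / 4) * rankOne ψ i j := by
    have h3 : ∀ s t, (starRingEnd ℂ) (sgn s t j) = sgn s t j := fun s t => by simp [sgn]
    simp only [Fin.sum_univ_two, Matrix.add_apply, Matrix.smul_apply, rankOne_apply, map_mul, h3,
      Complex.real_smul]
    push_cast
    ring
  rw [h2, h1]
  simp only [toX, xMat]
  by_cases h3 : j = i
  · subst h3; simp
  by_cases h4 : j = bitFlip i
  · subst h4; simp
  simp [h3, h4]

theorem toX_mem_hull {S : Set Mat} (hS : ∀ M ∈ S, ∃ ψ, M = rankOne ψ ∧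
    ∀ s t, rankOne (fun i => sgn s t i * ψ i) ∈ S) {M : Mat}
    (hM : M ∈ PointedCone.hull ℝ S) : toX M ∈ PointedCone.hull ℝ S := by
  induction hM using Submodule.span_induction with
  | mem x hx =>
    obtain ⟨ψ, rfl, h⟩ := hS x hx
    rw [toX_rankOne]
    exact sum_mem fun s _ => sum_mem fun t _ => Submodule.smul_mem _
      (⟨1 / 4, by norm_num⟩ : {c : ℝ // 0 ≤ c}) (Submodule.subset_span (h s t))
  | zero => rw [toX_zero]; exact zero_mem _
  | add x y _ _ hx hy => rw [toX_add]; exact add_mem hx hy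
  | smul c x _ hx =>
    have : toX (c • x) = c • toX x := toX_smul c.1 x
    rw [this]
    exact Submodule.smul_mem _ c hx

theorem toX_mem_sepA {M : Mat} (hM : M ∈ sepA) : toX M ∈ sepA := by
  refine toX_mem_hull ?_ hM
  rintro _ ⟨x, y, rfl⟩
  refine ⟨_, rfl, fun s t => ⟨fun i => (-1) ^ ((s : ℕ) * i) * x i,
    fun q => (-1) ^ ((t : ℕ) * q.1 + (s + t : ℕ) * q.2) * y q, congrArg rankOne ?_⟩⟩
  funext i
  simp only [sgn, prodA]
  ring

theorem toX_mem_sepB {M : Mat} (hM : M ∈ sepB) : toX M ∈ sepB := by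
  refine toX_mem_hull ?_ hM
  rintro _ ⟨x, y, rfl⟩
  refine ⟨_, rfl, fun s t => ⟨fun i => (-1) ^ ((t : ℕ) * i) * x i,
    fun q => (-1) ^ ((s : ℕ) * q.2 + (s + t : ℕ) * q.1) * y q, congrArg rankOne ?_⟩⟩
  funext i
  simp only [sgn, prodB]
  ring

theorem toX_mem_sepC {M : Mat} (hM : M ∈ sepC) : toX M ∈ sepC := by
  refine toX_mem_hull ?_ hM
  rintro _ ⟨x, y, rfl⟩
  refine ⟨_, rfl, fun s t => ⟨fun i => (-1) ^ ((s + t : ℕ) * i) * x i,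
    fun q => (-1) ^ ((s : ℕ) * q.1 + (t : ℕ) * q.2) * y q, congrArg rankOne ?_⟩⟩
  funext i
  simp only [sgn, prodC]
  ring

/-! ### Sufficiency of the inequalities for A-BC. -/

theorem xMat_add (d o d' o' : Idx → ℂ) : xMat d o + xMat d' o' = xMat (d + d') (o + o') := by
  ext i j
  simp only [xMat, Matrix.add_apply, Pi.add_apply]
  split_ifs <;> simp

theorem diagonal_mem_sepA (d : Idx → ℝ) (hd : 0 ≤ d) : xMat (fun i => (d i : ℂ)) 0 ∈ sepA := by
  have h : xMat (fun i => (d i : ℂ)) 0 =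
      ∑ k : Idx, d k • rankOne (prodA (Pi.single k.1 1) (Pi.single k.2 1)) := by
    have h1 : ∀ k : Idx, prodA (Pi.single k.1 1) (Pi.single k.2 1) = Pi.single k 1 := by
      rintro ⟨k, l⟩
      funext ⟨i, j⟩
      by_cases hi : i = k <;> by_cases hj : j = l <;> simp [prodA, hi, hj]
    ext i j
    simp only [h1, Matrix.sum_apply, Matrix.smul_apply, rankOne_apply, xMat, Pi.single_apply]
    by_cases hij : j = i
    · subst hij
      simp [apply_ite]
    · simp only [hij, if_false, Pi.zero_apply, ite_self]
      refine (Finset.sum_eq_zero fun k _ => ?_).symm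
      by_cases hk : i = k
      · have : j ≠ k := fun h => hij (h.trans hk.symm)
        simp [this]
      · simp [hk]
  rw [h]
  exact sum_mem fun k _ => Submodule.smul_mem _ (⟨d k, hd k⟩ : {c : ℝ // 0 ≤ c})
    (Submodule.subset_span ⟨_, _, rfl⟩)

/-- The X-shaped matrix supported on the four indices `(0, p)`, `(1, p)`, `(0, p')`, `(1, p')`,
where `p'` is the opposite of `p`. -/
def block (p : Fin 2 × Fin 2) (a b c d : ℝ) (z u : ℂ) : Mat :=
  xMat
    (fun i => if i = (0, p) then (a : ℂ) else if i = bitFlip (0, p) then (b : ℂ) else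
      if i = (1, p) then (c : ℂ) else if i = bitFlip (1, p) then (d : ℂ) else 0)
    (fun i => if i = (0, p) then z else if i = bitFlip (0, p) then (starRingEnd ℂ) z else
      if i = (1, p) then u else if i = bitFlip (1, p) then (starRingEnd ℂ) u else 0)

theorem block_add (p : Fin 2 × Fin 2) (a b c d a' b' c' d' : ℝ) (z u z' u' : ℂ) :
    block p a b c d z u + block p a' b' c' d' z' u' =
      block p (a + a') (b + b') (c + c') (d + d') (z + z') (u + u') := by
  simp only [block, xMat_add]
  congr 1 <;>
  · funext i
    simp only [Pi.add_apply]
    split_ifs <;> simp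

theorem block_diagonal_mem_sepA (p : Fin 2 × Fin 2) {a b c d : ℝ} (ha : 0 ≤ a) (hb : 0 ≤ b)
    (hc : 0 ≤ c) (hd : 0 ≤ d) : block p a b c d 0 0 ∈ sepA := by
  have := diagonal_mem_sepA (fun i => if i = (0, p) then a else if i = bitFlip (0, p) then b else
      if i = (1, p) then c else if i = bitFlip (1, p) then d else 0)
      (fun i => by dsimp only [Pi.zero_apply]; split_ifs <;> first | assumption | exact le_rfl)
  convert this using 1
  rw [block]
  congr 1
  · funext i
    split_ifs <;> simp
  · funext i
    simp

theorem smul_mem_sepA {c : ℝ} (hc : 0 ≤ c) {M : Mat} (hM : M ∈ sepA) : c • M ∈ sepA :=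
  Submodule.smul_mem sepA (⟨c, hc⟩ : {c : ℝ // 0 ≤ c}) hM

/-- Supplies the two free phases of a product vector, chosen so that the two anti-diagonal entries
of its block get arbitrary independent arguments. -/
theorem exists_unit_pair (θ φ : ℝ) : ∃ ξ η : ℂ, ξ * (starRingEnd ℂ) ξ = 1 ∧
    η * (starRingEnd ℂ) η = 1 ∧ (starRingEnd ℂ) ξ * (starRingEnd ℂ) η = Complex.exp (θ * Complex.I) ∧
    ξ * (starRingEnd ℂ) η = Complex.exp (φ * Complex.I) := by
  refine ⟨Complex.exp (((φ - θ) / 2 : ℝ) * Complex.I),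
    Complex.exp ((-(φ + θ) / 2 : ℝ) * Complex.I), ?_, ?_, ?_, ?_⟩ <;>
  · simp only [← Complex.exp_conj, ← Complex.exp_add, map_mul, Complex.conj_I, Complex.conj_ofReal]
    try rw [← Complex.exp_zero]
    congr 1
    push_cast
    ring

/-- The block is the X-part of the product vector `(a, cξ) ⊗ (e_p + (m/(ac)) η e_p')`, with `p'`
opposite to `p`. -/
theorem block_pure_mem_sepA (p : Fin 2 × Fin 2) {a c m : ℝ} (ha : 0 < a) (hc : 0 < c) (θ φ : ℝ) :
    block p (a ^ 2) ((m / a) ^ 2) (c ^ 2) ((m / c) ^ 2) (m * Complex.exp (θ * Complex.I))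
      (m * Complex.exp (φ * Complex.I)) ∈ sepA := by
  obtain ⟨ξ, η, hξ, hη, h1, h2⟩ := exists_unit_pair θ φ
  have hac : (a : ℂ) ≠ 0 := by exact_mod_cast ha.ne'
  have hcc : (c : ℂ) ≠ 0 := by exact_mod_cast hc.ne'
  have key : block p (a ^ 2) ((m / a) ^ 2) (c ^ 2) ((m / c) ^ 2) (m * Complex.exp (θ * Complex.I))
      (m * Complex.exp (φ * Complex.I)) = toX (rankOne (prodA ![(a : ℂ), c * ξ]
        (fun q => if q = p then 1 else if q = (p.1.rev, p.2.rev) then m / (a * c) * η else 0))) := by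
    rw [block, toX]
    simp only [map_mul, ← h1, ← h2, Complex.conj_ofReal]
    obtain ⟨j, k⟩ := p
    congr 1 <;> funext ⟨i, j', k'⟩ <;> fin_cases j <;> fin_cases k <;> fin_cases i <;>
      fin_cases j' <;> fin_cases k' <;> simp [prodA, rankOne_apply, bitFlip] <;> field_simp <;>
      first
      | linear_combination -hξ
      | linear_combination -(m : ℂ) ^ 2 * hη
      | linear_combination -(m : ℂ) ^ 2 * η * (starRingEnd ℂ) η * hξ - (m : ℂ) ^ 2 * hη
  rw [key]
  exact toX_mem_sepA (Submodule.subset_span ⟨_, _, rfl⟩)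

/-- A point of a disk is the midpoint of a chord perpendicular to its radius, with endpoints on the
circle at angles `arg z ± arccos (‖z‖ / m)`. -/
theorem exists_angles {m : ℝ} (hm : 0 < m) {z : ℂ} (hz : ‖z‖ ≤ m) : ∃ θ φ : ℝ,
    z = (m * Complex.exp (θ * Complex.I) + m * Complex.exp (φ * Complex.I)) / 2 := by
  refine ⟨z.arg + Real.arccos (‖z‖ / m), z.arg - Real.arccos (‖z‖ / m), ?_⟩
  have h1 : Real.cos (Real.arccos (‖z‖ / m)) = ‖z‖ / m :=
    Real.cos_arccos (le_trans (by norm_num) (div_nonneg (norm_nonneg z) hm.le))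
      ((div_le_one hm).2 hz)
  have h2 := congrArg (fun x : ℝ => (m : ℂ) * Complex.exp (z.arg * Complex.I) * (x : ℂ)) h1
  have hmc : (m : ℂ) ≠ 0 := by exact_mod_cast hm.ne'
  simp only [Complex.ofReal_cos, Complex.cos] at h2
  push_cast at h2 ⊢
  have h3 : (m : ℂ) * Complex.exp (z.arg * Complex.I) * (‖z‖ / m) = z := by
    rw [mul_comm (m : ℂ), mul_assoc, mul_div_cancel₀ _ hmc, mul_comm, Complex.norm_mul_exp_arg_mul_I]
  rw [h3] at h2
  refine h2.symm.trans ?_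
  rw [add_mul, sub_mul, sub_eq_add_neg, Complex.exp_add, Complex.exp_add, neg_mul]
  ring

theorem block_midpoint (p : Fin 2 × Fin 2) (a b c d : ℝ) (z u z' u' : ℂ) :
    block p a b c d ((z + z') / 2) ((u + u') / 2) =
      (1 / 2 : ℝ) • (block p a b c d z u + block p a b c d z' u') := by
  rw [block_add]
  ext i j
  simp only [block, xMat, Matrix.smul_apply, Complex.real_smul]
  have h2 : (starRingEnd ℂ) 2 = 2 := Complex.conj_ofNat 2
  split_ifs <;> simp [h2] <;> ring

/-- Separability of block matrices. -/
theorem block_mem_sepA (p : Fin 2 × Fin 2) {a b c d : ℝ} (ha : 0 ≤ a) (hb : 0 ≤ b)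
    (hc : 0 ≤ c) (hd : 0 ≤ d) {z u : ℂ} (hz : ‖z‖ ≤ √(a * b)) (hz' : ‖z‖ ≤ √(c * d))
    (hu : ‖u‖ ≤ √(a * b)) (hu' : ‖u‖ ≤ √(c * d)) : block p a b c d z u ∈ sepA := by
  obtain ⟨m, hm, hzm, hum, hab, hcd⟩ : ∃ m : ℝ, 0 ≤ m ∧ ‖z‖ ≤ m ∧ ‖u‖ ≤ m ∧ m ≤ √(a * b) ∧
      m ≤ √(c * d) :=
    -- Pure blocks have both anti-diagonal entries of the same modulus, so one radius must serve `z`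
    -- and `u`.
    ⟨max ‖z‖ ‖u‖, le_max_of_le_left (norm_nonneg _), le_max_left _ _, le_max_right _ _,
      max_le hz hu, max_le hz' hu'⟩
  rcases hm.eq_or_lt with rfl | hm
  · rw [norm_le_zero_iff.1 hzm, norm_le_zero_iff.1 hum]
    exact block_diagonal_mem_sepA p ha hb hc hd
  have hab' := (Real.le_sqrt' hm).1 hab
  have hcd' := (Real.le_sqrt' hm).1 hcd
  have ha' : 0 < a := ha.lt_of_ne fun h => by subst h; nlinarith
  have hc' : 0 < c := hc.lt_of_ne fun h => by subst h; nlinarith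
  have hb' : 0 ≤ b - (m / √a) ^ 2 := by
    rw [div_pow, Real.sq_sqrt ha, sub_nonneg, div_le_iff₀ ha', mul_comm]
    exact hab'
  have hd' : 0 ≤ d - (m / √c) ^ 2 := by
    rw [div_pow, Real.sq_sqrt hc, sub_nonneg, div_le_iff₀ hc', mul_comm]
    exact hcd'
  obtain ⟨θ, θ', rfl⟩ := exists_angles hm hzm
  obtain ⟨φ, φ', rfl⟩ := exists_angles hm hum
  -- Half the sum of two pure blocks has the right `a`, `c`, `z`, `u`; the excess of `b` and `d` is
  -- added as a diagonal matrix.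
  have h1 := add_mem
    (smul_mem_sepA (by norm_num : (0 : ℝ) ≤ 1 / 2) (add_mem
      (block_pure_mem_sepA p (m := m) (Real.sqrt_pos.2 ha') (Real.sqrt_pos.2 hc') θ φ)
      (block_pure_mem_sepA p (m := m) (Real.sqrt_pos.2 ha') (Real.sqrt_pos.2 hc') θ' φ')))
    (block_diagonal_mem_sepA p (le_refl 0) hb' (le_refl 0) hd')
  rw [← block_midpoint, block_add, Real.sq_sqrt ha, Real.sq_sqrt hc] at h1
  simpa only [add_zero, add_sub_cancel] using h1

theorem conj_apply_of_mem {M : Mat} (hM : M ∈ XSpace) (i j : Idx) :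
    (starRingEnd ℂ) (M i j) = M j i := congrFun₂ hM.1 j i

theorem ofReal_re_of_mem {M : Mat} (hM : M ∈ XSpace) (i : Idx) : ((M i i).re : ℂ) = M i i :=
  Complex.conj_eq_iff_re.1 (conj_apply_of_mem hM i i)

theorem mem_sepA {M : Mat} (hM : M ∈ XSpace) (hd : DiagNonneg M)
    (h : Dominates (1, 1) (diagMean M) (antiAbs M)) : M ∈ sepA := by
  have key : M = ∑ k : Fin 2, block (0, k) (M (0, 0, k) (0, 0, k)).re
      (M (bitFlip (0, 0, k)) (bitFlip (0, 0, k))).re (M (1, 0, k) (1, 0, k)).re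
      (M (bitFlip (1, 0, k)) (bitFlip (1, 0, k))).re (M (0, 0, k) (bitFlip (0, 0, k)))
      (M (1, 0, k) (bitFlip (1, 0, k))) := by
    conv_lhs => rw [← toX_of_mem hM]
    simp only [Fin.sum_univ_two, block, xMat_add, toX, ofReal_re_of_mem hM, conj_apply_of_mem hM]
    congr 1 <;> funext ⟨i, j, k⟩ <;> fin_cases i <;> fin_cases j <;> fin_cases k <;>
      simp [bitFlip]
  rw [key]
  refine sum_mem fun k _ => ?_
  have h1 := h (0, k)
  have h2 := h ((0, k) + (1, 1))
  rw [pair_add_self] at h2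
  -- The chosen representative is the flip of `(1, 0, k)`, whence the swapped factors and the
  -- conjugate entry below.
  have h3 : rep ((0, k) + (1, 1)) = bitFlip (1, 0, k) := by clear * -; revert k; decide
  simp only [diagMean, antiAbs, h3, bitFlip_bitFlip] at h1 h2
  rw [mul_comm (M _ _).re (M (1, 0, k) (1, 0, k)).re, ← conj_apply_of_mem hM, RCLike.norm_conj] at h2
  rw [mul_comm (M (bitFlip (1, 0, k)) _).re] at h1
  exact block_mem_sepA _ (hd _) (hd _) (hd _) (hd _) h1.1 h1.2 h2.2 h2.1

/-! ### Transport to the other two bipartitions by cyclic symmetry. -/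

/-- The cyclic permutation of the three systems. -/
def cycle : Idx ≃ Idx where
  toFun i := (i.2.1, i.2.2, i.1)
  invFun i := (i.2.2, i.1, i.2.1)
  left_inv _ := rfl
  right_inv _ := rfl

theorem submatrix_mem_hull (e : Idx ≃ Idx) {S T : Set Mat}
    (hST : ∀ M ∈ S, M.submatrix e e ∈ T) {M : Mat} (hM : M ∈ PointedCone.hull ℝ S) :
    M.submatrix e e ∈ PointedCone.hull ℝ T := by
  induction hM using Submodule.span_induction with
  | mem x hx => exact Submodule.subset_span (hST x hx)
  | zero => exact zero_mem _
  | add x y _ _ hx hy => exact add_mem hx hy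
  | smul c x _ hx => exact Submodule.smul_mem _ c hx

theorem mem_sepB_of_submatrix {M : Mat} (hM : M.submatrix cycle.symm cycle.symm ∈ sepA) :
    M ∈ sepB := by
  refine submatrix_mem_hull cycle (M := M.submatrix cycle.symm cycle.symm) ?_ hM
  rintro _ ⟨x, y, rfl⟩
  exact ⟨x, y, rfl⟩

theorem mem_sepC_of_submatrix {M : Mat} (hM : M.submatrix cycle.symm cycle.symm ∈ sepB) :
    M ∈ sepC := by
  refine submatrix_mem_hull cycle (M := M.submatrix cycle.symm cycle.symm) ?_ hM
  rintro _ ⟨x, y, rfl⟩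
  exact ⟨x, y, rfl⟩

theorem submatrix_mem_XSpace {M : Mat} (hM : M ∈ XSpace) :
    M.submatrix cycle.symm cycle.symm ∈ XSpace :=
  ⟨hM.1.submatrix _, fun _ _ h h' => hM.2 _ _ (fun e => h (cycle.symm.injective e))
    fun e => h' (cycle.symm.injective e)⟩

theorem diagMean_pairOf (M : Mat) (i : Idx) :
    diagMean M (pairOf i) = √((M i i).re * (M (bitFlip i) (bitFlip i)).re) := by
  have h : ∀ j, i = j ∨ i = bitFlip j →
      √((M j j).re * (M (bitFlip j) (bitFlip j)).re) =
        √((M i i).re * (M (bitFlip i) (bitFlip i)).re) := by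
    rintro j (rfl | rfl)
    · rfl
    · rw [bitFlip_bitFlip, mul_comm]
  exact h _ (eq_rep_pairOf i)

theorem antiAbs_pairOf {M : Mat} (hM : M ∈ XSpace) (i : Idx) :
    antiAbs M (pairOf i) = ‖M i (bitFlip i)‖ := by
  have h : ∀ j, i = j ∨ i = bitFlip j → ‖M j (bitFlip j)‖ = ‖M i (bitFlip i)‖ := by
    rintro j (rfl | rfl)
    · rfl
    · rw [bitFlip_bitFlip, ← conj_apply_of_mem hM, RCLike.norm_conj]
  exact h _ (eq_rep_pairOf i)

theorem Dominates.submatrix {M : Mat} (hM : M ∈ XSpace) {t t' : Pair}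
    (ht : t = (t'.2, t'.1 + t'.2)) (h : Dominates t (diagMean M) (antiAbs M)) :
    Dominates t' (diagMean (M.submatrix cycle.symm cycle.symm))
      (antiAbs (M.submatrix cycle.symm cycle.symm)) := by
  have h0 : ∀ i, cycle.symm (bitFlip i) = bitFlip (cycle.symm i) := fun _ => rfl
  have h1 : ∀ v, diagMean (M.submatrix cycle.symm cycle.symm) v =
      diagMean M (pairOf (cycle.symm (rep v))) := fun v => by
    rw [diagMean_pairOf]; rfl
  have h2 : ∀ v, antiAbs (M.submatrix cycle.symm cycle.symm) v =
      antiAbs M (pairOf (cycle.symm (rep v))) := fun v => by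
    rw [antiAbs_pairOf hM]; rfl
  have h3 : ∀ v, pairOf (cycle.symm (rep (v + t'))) = pairOf (cycle.symm (rep v)) + t := by
    subst ht; clear * -; revert t'; decide
  intro v
  simp only [h1, h2, h3]
  exact h _

theorem mem_sepB {M : Mat} (hM : M ∈ XSpace) (hd : DiagNonneg M)
    (h : Dominates (1, 0) (diagMean M) (antiAbs M)) : M ∈ sepB :=
  mem_sepB_of_submatrix (mem_sepA (submatrix_mem_XSpace hM) (fun _ => hd _)
    (h.submatrix hM (by decide)))

theorem mem_sepC {M : Mat} (hM : M ∈ XSpace) (hd : DiagNonneg M)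
    (h : Dominates (0, 1) (diagMean M) (antiAbs M)) : M ∈ sepC :=
  mem_sepC_of_submatrix (mem_sepB (submatrix_mem_XSpace hM) (fun _ => hd _)
    (h.submatrix hM (by decide)))

/-! ### Lifting splittings of the invariants to matrices. -/

/-- Rescaling of the diagonal and of the anti-diagonal of a matrix, pair by pair. -/
def rescale (s t : Pair → ℝ) (M : Mat) : Mat :=
  toX (xMat (fun i => s (pairOf i) * M i i) (fun i => t (pairOf i) * M i (bitFlip i)))

theorem toX_xMat (d o : Idx → ℂ) : toX (xMat d o) = xMat d o := by
  simp [toX, xMat]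

theorem rescale_mem {s t : Pair → ℝ} {M : Mat} (hM : M ∈ XSpace) : rescale s t M ∈ XSpace := by
  refine toX_mem ?_
  ext i j
  by_cases h1 : i = j
  · subst h1; simp [xMat, conj_apply_of_mem hM]
  by_cases h2 : i = bitFlip j
  · subst h2; simp [xMat, conj_apply_of_mem hM]
  have h3 : j ≠ bitFlip i := fun h' => h2 (by rw [h', bitFlip_bitFlip])
  simp [xMat, h1, Ne.symm h1, h2, h3]

theorem rescale_diag (s t : Pair → ℝ) (M : Mat) (i : Idx) :
    (rescale s t M i i).re = s (pairOf i) * (M i i).re := by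
  simp [rescale, toX, xMat]

theorem diagMean_rescale {s t : Pair → ℝ} (hs : 0 ≤ s) (M : Mat) :
    diagMean (rescale s t M) = s * diagMean M := by
  funext v
  have h : ∀ x y : ℝ, s v * x * (s v * y) = s v ^ 2 * (x * y) := fun x y => by ring
  have hv : 0 ≤ s v := hs v
  simp only [diagMean, rescale_diag, pairOf_bitFlip, pairOf_rep, h, Pi.mul_apply]
  rw [Real.sqrt_mul (sq_nonneg _), Real.sqrt_sq hv]

theorem antiAbs_rescale {s t : Pair → ℝ} (ht : 0 ≤ t) (M : Mat) :
    antiAbs (rescale s t M) = t * antiAbs M := by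
  funext v
  have hv : 0 ≤ t v := ht v
  simp [antiAbs, rescale, toX, xMat, abs_of_nonneg hv]

theorem rescale_add_rescale {s t s' t' : Pair → ℝ} (hs : s + s' = 1) (ht : t + t' = 1) {M : Mat}
    (hM : M ∈ XSpace) : rescale s t M + rescale s' t' M = M := by
  have h1 : ∀ v, (s v : ℂ) + s' v = 1 := fun v => by exact_mod_cast congrFun hs v
  have h2 : ∀ v, (t v : ℂ) + t' v = 1 := fun v => by exact_mod_cast congrFun ht v
  conv_rhs => rw [← toX_of_mem hM]
  rw [rescale, rescale, toX_xMat, toX_xMat, xMat_add, toX]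
  congr 1 <;> funext i <;> simp only [Pi.add_apply, ← add_mul, h1, h2, one_mul]

theorem exists_ratio {f g : Pair → ℝ} (hf : 0 ≤ f) (hg : 0 ≤ g) :
    ∃ s s' : Pair → ℝ, 0 ≤ s ∧ 0 ≤ s' ∧ s + s' = 1 ∧ s * (f + g) = f ∧ s' * (f + g) = g := by
  have h : ∀ v, ∃ x y : ℝ, 0 ≤ x ∧ 0 ≤ y ∧ x + y = 1 ∧ x * (f v + g v) = f v ∧
      y * (f v + g v) = g v := by
    intro v
    have h1 : 0 ≤ f v := hf v
    have h2 : 0 ≤ g v := hg v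
    rcases (add_nonneg h1 h2).eq_or_lt with h0 | h0
    -- Both values vanish here, so any weights with sum 1 would do.
    · exact ⟨1, 0, zero_le_one, le_rfl, by norm_num, by linarith, by linarith⟩
    · refine ⟨f v / (f v + g v), g v / (f v + g v), by positivity, by positivity, ?_, ?_, ?_⟩ <;>
        field_simp
  choose s s' h using h
  exact ⟨s, s', fun v => (h v).1, fun v => (h v).2.1, funext fun v => (h v).2.2.1,
    funext fun v => (h v).2.2.2.1, funext fun v => (h v).2.2.2.2⟩

/-- A splitting of the invariants of an X-shaped matrix lifts to the matrix. -/
theorem exists_splitting {M : Mat} (hM : M ∈ XSpace) (hd : DiagNonneg M) {r w r' w' : Pair → ℝ}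
    (hr : 0 ≤ r) (hw : 0 ≤ w) (hr' : 0 ≤ r') (hw' : 0 ≤ w') (h : diagMean M = r + r')
    (h' : antiAbs M = w + w') :
    ∃ N N' : Mat, N ∈ XSpace ∧ N' ∈ XSpace ∧ DiagNonneg N ∧ DiagNonneg N' ∧ M = N + N' ∧
      diagMean N = r ∧ antiAbs N = w ∧ diagMean N' = r' ∧ antiAbs N' = w' := by
  obtain ⟨s, s', hs, hs', hss, e1, e2⟩ := exists_ratio hr hr'
  obtain ⟨t, t', ht, ht', htt, e3, e4⟩ := exists_ratio hw hw'
  refine ⟨rescale s t M, rescale s' t' M, rescale_mem hM, rescale_mem hM, fun i => ?_, fun i => ?_,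
    (rescale_add_rescale hss htt hM).symm, ?_, ?_, ?_, ?_⟩
  · rw [rescale_diag]; exact mul_nonneg (hs _) (hd i)
  · rw [rescale_diag]; exact mul_nonneg (hs' _) (hd i)
  · rw [diagMean_rescale hs, h, e1]
  · rw [antiAbs_rescale ht, h', e3]
  · rw [diagMean_rescale hs', h, e2]
  · rw [antiAbs_rescale ht', h', e4]

/-! ### The lattice identity for three abstract cones. -/

/-- The properties of the cone `σ` of states separable for one bipartition that are needed here. -/
structure IsSepCone (t : Pair) (σ : PointedCone ℝ Mat) : Prop where
  admissible : ∀ M ∈ σ, Admissible t M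
  mem : ∀ M ∈ XSpace, DiagNonneg M → Dominates t (diagMean M) (antiAbs M) → M ∈ σ
  toX_mem : ∀ M ∈ σ, toX M ∈ σ

theorem isSepCone_sepA : IsSepCone (1, 1) sepA :=
  ⟨fun _ => admissible_of_mem_sepA, fun _ => mem_sepA, fun _ => toX_mem_sepA⟩

theorem isSepCone_sepB : IsSepCone (1, 0) sepB :=
  ⟨fun _ => admissible_of_mem_sepB, fun _ => mem_sepB, fun _ => toX_mem_sepB⟩

theorem isSepCone_sepC : IsSepCone (0, 1) sepC :=
  ⟨fun _ => admissible_of_mem_sepC, fun _ => mem_sepC, fun _ => toX_mem_sepC⟩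

theorem xPart_mono {σ τ : PointedCone ℝ Mat} (h : σ ≤ τ) : xPart σ ≤ xPart τ :=
  inf_le_inf_right _ h

theorem IsSepCone.xPart_sup_le {s t : Pair} {σ τ : PointedCone ℝ Mat} (hσ : IsSepCone s σ)
    (hτ : IsSepCone t τ) : xPart (σ ⊔ τ) ≤ xPart σ ⊔ xPart τ := by
  rintro M ⟨hM, hX⟩
  obtain ⟨N, hN, N', hN', rfl⟩ := Submodule.mem_sup.1 hM
  rw [← toX_of_mem hX, toX_add]
  exact Submodule.add_mem_sup ⟨hσ.toX_mem N hN, ThreeQubit.toX_mem (hσ.admissible N hN).1⟩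
    ⟨hτ.toX_mem N' hN', ThreeQubit.toX_mem (hτ.admissible N' hN').1⟩

theorem xPart_le (σ : PointedCone ℝ Mat) : xPart σ ≤ σ := inf_le_left

theorem IsSepCone.joint {s t : Pair} {σ τ : PointedCone ℝ Mat} (hσ : IsSepCone s σ)
    (hτ : IsSepCone t τ) {M : Mat} (hM : M ∈ σ ⊔ τ) :
    DiagNonneg M ∧ JointlyDominates s t (diagMean M) (antiAbs M) := by
  obtain ⟨N, hN, N', hN', rfl⟩ := Submodule.mem_sup.1 hM
  have h1 := hσ.admissible N hN
  have h2 := hτ.admissible N' hN'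
  exact ⟨fun i => add_nonneg (h1.2.1 i) (h2.2.1 i),
    (h1.2.2.joint h2.2.2).mono (diagMean_add_le h1.2.1 h2.2.1) (antiAbs_add_le N N')⟩

/-- The splitting is lifted twice: first `M = M₁ + N`, then `N = M₂ + M₃`. Here `N` is in `υ` by its
own invariants and in `σ ⊔ τ` by its summands. -/
theorem mem_of_splits {a b c : Pair} {σ τ υ : PointedCone ℝ Mat} (hσ : IsSepCone a σ)
    (hτ : IsSepCone b τ) (hυ : IsSepCone c υ) {M : Mat} (hM : M ∈ XSpace) (hd : DiagNonneg M)
    (h : Splits a b c (diagMean M) (antiAbs M)) : M ∈ xPart σ ⊔ xPart (υ ⊓ (σ ⊔ τ)) := by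
  obtain ⟨r₁, w₁, r₂, w₂, r₃, w₃, ⟨hr₁, hw₁, hr₂, hw₂, hr₃, hw₃⟩, hr, hw, h₁, h₂, h₃, h₄⟩ := h
  obtain ⟨M₁, N, hM₁, hN, hd₁, hdN, rfl, rfl, rfl, hrN, hwN⟩ := exists_splitting hM hd hr₁ hw₁
    (add_nonneg hr₂ hr₃) (add_nonneg hw₂ hw₃) hr hw
  rw [← hrN, ← hwN] at h₄
  obtain ⟨M₂, M₃, hM₂, hM₃, hd₂, hd₃, rfl, rfl, rfl, rfl, rfl⟩ := exists_splitting hN hdN hr₂ hw₂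
    hr₃ hw₃ hrN hwN
  exact Submodule.add_mem_sup ⟨hσ.mem _ hM₁ hd₁ h₁, hM₁⟩ ⟨⟨hυ.mem _ hN hdN h₄,
    Submodule.add_mem_sup (hσ.mem _ hM₂ hd₂ h₂) (hτ.mem _ hM₃ hd₃ h₃)⟩, hN⟩

/-- Stated for abstract cones so that the three identities are its instances under cyclic renaming;
`hρ` absorbs the reordering of the joins in `Q`. -/
theorem sup_inf_sup_eq {a b c : Pair} (ha : a ≠ 0) (hb : b ≠ 0) (hab : a ≠ b) (hc : c = a + b)
    {σ τ υ ρ : PointedCone ℝ Mat} (hσ : IsSepCone a σ) (hτ : IsSepCone b τ) (hυ : IsSepCone c υ)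
    (hρ : ρ = σ ⊓ (τ ⊔ υ) ⊔ τ ⊓ (υ ⊔ σ) ⊔ υ ⊓ (σ ⊔ τ)) :
    (xPart σ ⊔ xPart τ) ⊓ (xPart σ ⊔ xPart υ) = xPart σ ⊔ xPart ρ := by
  apply le_antisymm
  · rintro M ⟨h1, h2⟩
    have hX : M ∈ XSpace := by
      obtain ⟨N, hN, N', hN', rfl⟩ := Submodule.mem_sup.1 h1
      exact XSpace.add_mem hN.2 hN'.2
    obtain ⟨hd, j1⟩ := hσ.joint hτ (sup_le_sup (xPart_le σ) (xPart_le τ) h1)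
    obtain ⟨-, j2⟩ := hσ.joint hυ (sup_le_sup (xPart_le σ) (xPart_le υ) h2)
    rcases dominates_or_splits ha hb hab hc (antiAbs_nonneg M) j1 j2 with h | h | h
    · exact Submodule.mem_sup_left ⟨hσ.mem M hX hd h, hX⟩
    · refine sup_le_sup_left (xPart_mono ?_) _ (mem_of_splits hσ hτ hυ hX hd h)
      exact hρ ▸ le_sup_right
    · refine sup_le_sup_left (xPart_mono ?_) _ (mem_of_splits hσ hυ hτ hX hd h)
      rw [hρ, sup_comm υ σ]
      exact le_sup_of_le_left le_sup_right
  · refine le_inf (sup_le le_sup_left ?_) (sup_le le_sup_left ?_)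
    · refine (xPart_mono ?_).trans (hσ.xPart_sup_le hτ)
      rw [hρ]
      exact sup_le (sup_le (inf_le_left.trans le_sup_left) (inf_le_left.trans le_sup_right))
        inf_le_right
    · refine (xPart_mono ?_).trans (hσ.xPart_sup_le hυ)
      rw [hρ, sup_comm υ σ]
      exact sup_le (sup_le (inf_le_left.trans le_sup_left) inf_le_right)
        (inf_le_left.trans le_sup_right)

end ThreeQubit

end

theorem corollary5p3 :
    (ThreeQubit.xPart ThreeQubit.sepA ⊔ ThreeQubit.xPart ThreeQubit.sepB) ⊓
        (ThreeQubit.xPart ThreeQubit.sepA ⊔ ThreeQubit.xPart ThreeQubit.sepC) =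
      ThreeQubit.xPart ThreeQubit.sepA ⊔ ThreeQubit.xPart ThreeQubit.Q ∧
    (ThreeQubit.xPart ThreeQubit.sepB ⊔ ThreeQubit.xPart ThreeQubit.sepC) ⊓
        (ThreeQubit.xPart ThreeQubit.sepB ⊔ ThreeQubit.xPart ThreeQubit.sepA) =
      ThreeQubit.xPart ThreeQubit.sepB ⊔ ThreeQubit.xPart ThreeQubit.Q ∧
    (ThreeQubit.xPart ThreeQubit.sepC ⊔ ThreeQubit.xPart ThreeQubit.sepA) ⊓
        (ThreeQubit.xPart ThreeQubit.sepC ⊔ ThreeQubit.xPart ThreeQubit.sepB) =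
      ThreeQubit.xPart ThreeQubit.sepC ⊔ ThreeQubit.xPart ThreeQubit.Q := by
  refine ⟨ThreeQubit.sup_inf_sup_eq (by decide) (by decide) (by decide) (by decide)
      ThreeQubit.isSepCone_sepA ThreeQubit.isSepCone_sepB ThreeQubit.isSepCone_sepC rfl,
    ThreeQubit.sup_inf_sup_eq (by decide) (by decide) (by decide) (by decide)
      ThreeQubit.isSepCone_sepB ThreeQubit.isSepCone_sepC ThreeQubit.isSepCone_sepA ?_,
    ThreeQubit.sup_inf_sup_eq (by decide) (by decide) (by decide) (by decide)
      ThreeQubit.isSepCone_sepC ThreeQubit.isSepCone_sepA ThreeQubit.isSepCone_sepB ?_⟩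
  · rw [ThreeQubit.Q, sup_assoc, sup_comm]
  · rw [ThreeQubit.Q, sup_comm, sup_assoc]
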